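/- Let $w\in\mathbb C$ with $|w|=1$ (that is, $w=e^{i\varphi}$), and let all fractional powers be principal ones. Put $\eta(t)=\sqrt{3+4t^3}$, $\chi(t)=[3+2t^3+\sqrt3\,\eta(t)]^{1/3}$ and, for $\hat s\in\mathbb C\setminus\{0\}$, $$\alpha_1(\hat s)=\frac{\chi(\hat s\sqrt w)}{2^{1/3}\hat s}+\frac{2^{1/3}\hat s\,w}{\chi(\hat s\sqrt w)},$$ $$\alpha_2(\hat s)=-\frac{(1-i\sqrt3)\,\chi(\hat s\sqrt w)}{2^{4/3}\hat s}-\frac{(1+i\sqrt3)\,\hat s\,w}{2^{2/3}\chi(\hat s\sqrt w)},\qquad \alpha_3(\hat s)=-\frac{(1+i\sqrt3)\,\chi(\hat s\sqrt w)}{2^{4/3}\hat s}-\frac{(1-i\sqrt3)\,\hat s\,w}{2^{2/3}\chi(\hat s\sqrt w)}.$$ Let $(x)_p=x(x-1)\cdots(x-p+1)$, $h_p(x)=(4/3)^p(x)_p$ and $$T_m(x)=\sum_{k=1}^{m}\sum_{i=0}^{k}\sum_{l=0}^{k-i}(-1)^{k-i-l}\frac{2^{i-k}(3m)!}{3^i\,i!\,(m-i)!\,l!\,(k-i-l)!}\,(x)_k\,h_{m-i}\!\left(\tfrac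 l2\right),$$ $$a_{3m}=\chi^{(3m)}(0),\qquad b_{3m}=6^{-1/3}\left\{\delta_{m0}+T_m\!\left(-\tfrac13\right)\right\}\qquad(m\ge 0).$$ Then for every $\hat s$ with $0<|\hat s|<(3/4)^{1/3}$ the solutions $\alpha$ of $w\alpha-\alpha^3/3=-\tfrac23w^{3/2}-\hat s^{-3}$ are exactly $\alpha_1(\hat s),\alpha_2(\hat s),\alpha_3(\hat s)$, and $$\alpha_2(\hat s)=-\frac{1-i\sqrt3}{2^{4/3}}\sum_{m=0}^\infty\frac{a_{3m}}{(3m)!}w^{3m/2}\hat s^{3m-1}-\frac{1+i\sqrt3}{2^{2/3}}\,w\sum_{m=0}^\infty\frac{b_{3m}}{(3m)!}w^{3m/2}\hat s^{3m+1},$$ $$\alpha_3(\hat s)=-\frac{1+i\sqrt3}{2^{4/3}}\sum_{m=0}^\infty\frac{a_{3m}}{(3m)!}w^{3m/2}\hat s^{3m-1}-\frac{1-i\sqrt3}{2^{2/3}}\,w\sum_{m=0}^\infty\frac{b_{3m}}{(3m)!}w^{3m/2}\hat s^{3m+1}.$$ Both series converge absolutely at each such $\hat s$, and uniformly on the set $0<|\hat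 s|<(3/4)^{1/3}$. Moreover $a_0=6^{1/3}$ and $a_{3m}=6^{1/3}\,T_m(\tfrac13)$ for $m\ge1$. -/

import Mathlib

open Filter Topology

namespace AiryCubic

noncomputable section

/-- The function `η(t) = √(3 + 4 t³)` (principal branch). -/
def eta (t : ℂ) : ℂ := (3 + 4 * t ^ 3) ^ (1 / 2 : ℂ)

/-- The function `χ(t) = [3 + 2 t³ + √3 η(t)]^{1/3}` (principal branch). -/
def chi (t : ℂ) : ℂ := (3 + 2 * t ^ 3 + (Real.sqrt 3 : ℂ) * eta t) ^ (1 / 3 : ℂ)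

/-- The square root `√w = w^{1/2}` (principal branch). -/
def sqrtW (w : ℂ) : ℂ := w ^ (1 / 2 : ℂ)

/-- The first root `α₁(ŝ)` of the cubic equation. -/
def alpha1 (w s : ℂ) : ℂ :=
  chi (s * sqrtW w) / ((2 : ℂ) ^ (1 / 3 : ℂ) * s)
    + (2 : ℂ) ^ (1 / 3 : ℂ) * s * w / chi (s * sqrtW w)

/-- The second root `α₂(ŝ)` of the cubic equation. -/
def alpha2 (w s : ℂ) : ℂ :=
  -((1 - Complex.I * (Real.sqrt 3 : ℂ)) * chi (s * sqrtW w) / ((2 : ℂ) ^ (4 / 3 : ℂ) * s))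
    - (1 + Complex.I * (Real.sqrt 3 : ℂ)) * s * w / ((2 : ℂ) ^ (2 / 3 : ℂ) * chi (s * sqrtW w))

/-- The third root `α₃(ŝ)` of the cubic equation. -/
def alpha3 (w s : ℂ) : ℂ :=
  -((1 + Complex.I * (Real.sqrt 3 : ℂ)) * chi (s * sqrtW w) / ((2 : ℂ) ^ (4 / 3 : ℂ) * s))
    - (1 - Complex.I * (Real.sqrt 3 : ℂ)) * s * w / ((2 : ℂ) ^ (2 / 3 : ℂ) * chi (s * sqrtW w))

/-- The equation `w α - α³/3 = -(2/3) w^{3/2} - 1/ŝ³` for `α`. -/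
def IsCubicRoot (w s a : ℂ) : Prop :=
  w * a - a ^ 3 / 3 = -(2 / 3) * w ^ (3 / 2 : ℂ) - 1 / s ^ 3

/-- The falling factorial `(x)_p = x (x - 1) ⋯ (x - p + 1)`. -/
def fallingFactorial (x : ℂ) (p : ℕ) : ℂ := (descPochhammer ℂ p).eval x

/-- `h_p(x) = (4/3)^p (x)_p`. -/
def h (p : ℕ) (x : ℂ) : ℂ := (4 / 3 : ℂ) ^ p * fallingFactorial x p

/-- The triple sum
`∑_{k=1}^m ∑_{i=0}^k ∑_{l=0}^{k-i} (-1)^{k-i-l} 2^{i-k} (3m)! / (3^i i! (m-i)! l! (k-i-l)!)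
  (x)_k h_{m-i}(l/2)`. All natural-number subtractions in it are of a smaller number from
a larger one. -/
def tripleSum (x : ℂ) (m : ℕ) : ℂ :=
  ∑ k ∈ Finset.Icc 1 m, ∑ i ∈ Finset.range (k + 1), ∑ l ∈ Finset.range (k - i + 1),
    (-1 : ℂ) ^ (k - i - l)
      * ((2 : ℂ) ^ ((i : ℤ) - (k : ℤ)) * (Nat.factorial (3 * m) : ℂ)
        / ((3 : ℂ) ^ i * (Nat.factorial i : ℂ) * (Nat.factorial (m - i) : ℂ)
          * (Nat.factorial l : ℂ) * (Nat.factorial (k - i - l) : ℂ)))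
      * fallingFactorial x k * h (m - i) ((l : ℂ) / 2)

/-- The coefficient `a_{3m} = χ^{(3m)}(0)`, indexed by `m`. -/
def coeffA (m : ℕ) : ℂ := iteratedDeriv (3 * m) chi 0

/-- The coefficient `b_{3m}`, indexed by `m`. -/
def coeffB (m : ℕ) : ℂ :=
  (6 : ℂ) ^ (-(1 / 3) : ℂ) * ((if m = 0 then 1 else 0) + tripleSum (-(1 / 3)) m)

/-- The term `(a_{3m} / (3m)!) w^{3m/2} ŝ^{3m-1}` of the first series. -/
def termA (w : ℂ) (m : ℕ) (s : ℂ) : ℂ :=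
  coeffA m / (Nat.factorial (3 * m) : ℂ) * w ^ (3 * (m : ℂ) / 2) * s ^ (3 * (m : ℤ) - 1)

/-- The term `(b_{3m} / (3m)!) w^{3m/2} ŝ^{3m+1}` of the second series. -/
def termB (w : ℂ) (m : ℕ) (s : ℂ) : ℂ :=
  coeffB m / (Nat.factorial (3 * m) : ℂ) * w ^ (3 * (m : ℂ) / 2) * s ^ (3 * m + 1)

/-- The punctured disc `0 < |ŝ| < (3/4)^{1/3}`. -/
def puncturedDisc : Set ℂ := {s : ℂ | s ≠ 0 ∧ ‖s‖ < (3 / 4 : ℝ) ^ (1 / 3 : ℝ)}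

end

end AiryCubic

/-! Put `v = (4/3) t³`. Then `η = √3 √(1 + v)` and the radicand of `χ` is `6 ((1 + √(1 + v)) / 2)²`,
so for `|v| < 1` one has `χ^{±1} = 6^{±1/3} F_x(v)`, where `x = ±1/3` and `F_x` is `sqrtPower x`
(`chi_eq`, `inv_chi_eq`). As `|w| = 1`, the punctured disc corresponds exactly to `0 < |v| < 1`. The
Taylor coefficients of `F_x` are computed in two ways. Binomial expansion of `(1 + deviation)^x`
yields the triple sum (`tripleSum_eq`). A hypergeometric differential equation yields a two-term
recursion (`coeff_sqrtPower_succ`), and from it absolute summability at `|v| = 1`, hence uniform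
convergence up to the boundary by the Weierstrass test. That `α₁, α₂, α₃` are the roots is Cardano's
formula. -/

namespace AiryCubic

/-- The Taylor series of a function at the origin. -/
noncomputable def taylor (f : ℂ → ℂ) : PowerSeries ℂ :=
  PowerSeries.mk fun n => iteratedDeriv n f 0 / (n.factorial : ℂ)

/-! ### Taylor series at the origin: products, composition, binomial series. -/

section Taylor

open PowerSeries

variable {f g : ℂ → ℂ}

theorem coeff_taylor (f : ℂ → ℂ) (n : ℕ) :
    coeff n (taylor f) = iteratedDeriv n f 0 / (n.factorial : ℂ) := by
  simp [taylor]

theorem taylor_congr (hfg : f =ᶠ[𝓝 0] g) : taylor f = taylor g := by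
  ext n
  rw [coeff_taylor, coeff_taylor, hfg.iteratedDeriv_eq]

theorem taylor_add (hf : AnalyticAt ℂ f 0) (hg : AnalyticAt ℂ g 0) :
    taylor (fun z => f z + g z) = taylor f + taylor g := by
  ext n
  rw [map_add, coeff_taylor, coeff_taylor, coeff_taylor,
    iteratedDeriv_fun_add hf.contDiffAt hg.contDiffAt, add_div]

theorem taylor_mul (hf : AnalyticAt ℂ f 0) (hg : AnalyticAt ℂ g 0) :
    taylor (fun z => f z * g z) = taylor f * taylor g := by
  ext n
  rw [coeff_mul, coeff_taylor, iteratedDeriv_fun_mul hf.contDiffAt hg.contDiffAt,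
    Finset.Nat.sum_antidiagonal_eq_sum_range_succ
      (fun i j => coeff i (taylor f) * coeff j (taylor g)), Finset.sum_div]
  refine Finset.sum_congr rfl fun i hi => ?_
  have hin : i ≤ n := Nat.lt_succ_iff.mp (Finset.mem_range.mp hi)
  rw [coeff_taylor, coeff_taylor, Nat.cast_choose ℂ hin]
  have h1 := Nat.cast_ne_zero (R := ℂ).mpr i.factorial_ne_zero
  have h2 := Nat.cast_ne_zero (R := ℂ).mpr (n - i).factorial_ne_zero
  have h3 := Nat.cast_ne_zero (R := ℂ).mpr n.factorial_ne_zero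
  field_simp

theorem taylor_const (c : ℂ) : taylor (fun _ => c) = C c := by
  ext n
  rw [coeff_taylor, iteratedDeriv_const, coeff_C]
  split_ifs with h <;> simp [h]

theorem taylor_id : taylor (fun z => z) = X := by
  ext n
  rw [coeff_taylor, iteratedDeriv_fun_id_zero, coeff_X]
  split_ifs with h <;> simp [h]

theorem taylor_const_mul (c : ℂ) (hf : AnalyticAt ℂ f 0) :
    taylor (fun z => c * f z) = C c * taylor f := by
  rw [taylor_mul analyticAt_const hf, taylor_const]

theorem taylor_pow (hf : AnalyticAt ℂ f 0) (k : ℕ) :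
    taylor (fun z => f z ^ k) = taylor f ^ k := by
  induction k with
  | zero => simpa using taylor_const 1
  | succ k ih => simp_rw [pow_succ]; rw [taylor_mul (hf.fun_pow k) hf, ih]

theorem taylor_sum {ι : Type*} (s : Finset ι) {F : ι → ℂ → ℂ}
    (hF : ∀ i, AnalyticAt ℂ (F i) 0) :
    taylor (fun z => ∑ i ∈ s, F i z) = ∑ i ∈ s, taylor (F i) := by
  classical
  induction s using Finset.induction_on with
  | empty => simpa using taylor_const 0
  | insert a s ha ih =>
    simp_rw [Finset.sum_insert ha]
    rw [taylor_add (hF a) (Finset.analyticAt_fun_sum _ fun i _ => hF i), ih]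

theorem taylor_deriv (f : ℂ → ℂ) : taylor (deriv f) = d⁄dX ℂ (taylor f) := by
  ext n
  rw [coeff_derivative, coeff_taylor, coeff_taylor, ← iteratedDeriv_succ', Nat.factorial_succ]
  have := Nat.cast_ne_zero (R := ℂ).mpr n.factorial_ne_zero
  have : (n : ℂ) + 1 ≠ 0 := Nat.cast_add_one_ne_zero n
  push_cast
  field_simp

theorem constantCoeff_taylor (f : ℂ → ℂ) : constantCoeff (taylor f) = f 0 := by
  rw [← coeff_zero_eq_constantCoeff_apply, coeff_taylor]
  simp

theorem coeff_taylor_eq_of_hasFPowerSeriesAt {c : ℕ → ℂ}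
    (h : HasFPowerSeriesAt f (FormalMultilinearSeries.ofScalars ℂ c) 0) (n : ℕ) :
    coeff n (taylor f) = c n := by
  have := h.eq_formalMultilinearSeries h.analyticAt.hasFPowerSeriesAt
  rw [FormalMultilinearSeries.ofScalars_series_eq_iff] at this
  rw [coeff_taylor, this]

/-- Taylor expansion with an analytic remainder factor. -/
theorem exists_taylor_remainder (hf : AnalyticAt ℂ f 0) (m : ℕ) :
    ∃ R : ℂ → ℂ, AnalyticAt ℂ R 0 ∧
      ∀ z, f z = ∑ k ∈ Finset.range m, coeff k (taylor f) * z ^ k + z ^ m * R z := by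
  -- Any coefficients `r` in such an identity are the Taylor coefficients, as taking Taylor series
  -- of both sides shows; `dslope` then supplies the induction.
  suffices H : ∃ (r : ℕ → ℂ) (R : ℂ → ℂ), AnalyticAt ℂ R 0 ∧
      ∀ z, f z = ∑ k ∈ Finset.range m, r k * z ^ k + z ^ m * R z by
    obtain ⟨r, R, hR, h⟩ := H
    refine ⟨R, hR, fun z => ?_⟩
    rw [h z]
    congr 1
    refine Finset.sum_congr rfl fun k hk => ?_
    congr 1
    have hid : AnalyticAt ℂ (fun z : ℂ => z) 0 := analyticAt_id
    have hterm : ∀ i, AnalyticAt ℂ (fun z : ℂ => r i * z ^ i) 0 := fun i =>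
      analyticAt_const.mul (hid.fun_pow i)
    rw [funext h, taylor_add (Finset.analyticAt_fun_sum _ fun i _ => hterm i)
      ((hid.fun_pow m).fun_mul hR), taylor_sum _ hterm, taylor_mul (hid.fun_pow m) hR,
      taylor_pow hid, taylor_id]
    simp_rw [taylor_const_mul _ (hid.fun_pow _), taylor_pow hid, taylor_id]
    have hk' := Finset.mem_range.mp hk
    rw [map_add, map_sum, coeff_X_pow_mul', if_neg (by omega)]
    simp [coeff_X_pow, hk']
  induction m with
  | zero => exact ⟨0, f, hf, by simp⟩
  | succ m ih =>
    obtain ⟨r, R, hR, h⟩ := ih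
    obtain ⟨p, hp⟩ := hR
    refine ⟨fun k => if k = m then R 0 else r k, dslope R 0, ⟨_, hp.has_fpower_series_dslope_fslope⟩,
      fun z => ?_⟩
    have hz : R z = R 0 + z * dslope R 0 z := by
      have := sub_smul_dslope R 0 z
      simp only [sub_zero, smul_eq_mul] at this
      rw [this]; ring
    rw [h z, Finset.sum_range_succ, hz]
    beta_reduce
    rw [if_pos rfl]
    have : ∑ k ∈ Finset.range m, (if k = m then R 0 else r k) * z ^ k =
        ∑ k ∈ Finset.range m, r k * z ^ k :=
      Finset.sum_congr rfl fun k hk => by rw [if_neg (Finset.mem_range.mp hk).ne]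
    rw [this]
    ring

/-- Taylor coefficients of a composition. -/
theorem coeff_taylor_comp (hf : AnalyticAt ℂ f 0) (hg : AnalyticAt ℂ g 0) (hg0 : g 0 = 0)
    (n : ℕ) : coeff n (taylor fun z => f (g z)) =
      ∑ k ∈ Finset.range (n + 1), coeff k (taylor f) * coeff n (taylor g ^ k) := by
  obtain ⟨R, hR, h⟩ := exists_taylor_remainder hf (n + 1)
  have hRg : AnalyticAt ℂ (fun z => R (g z)) 0 := AnalyticAt.fun_comp (by rwa [hg0]) hg
  have hterm : ∀ k, AnalyticAt ℂ (fun z => coeff k (taylor f) * g z ^ k) 0 := fun k =>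
    analyticAt_const.mul (hg.fun_pow k)
  -- Hence the remainder `g^{n+1} · (R ∘ g)` contributes nothing to the coefficient of order `n`.
  have hX : X ∣ taylor g := by rw [X_dvd_iff, constantCoeff_taylor, hg0]
  rw [show (fun z => f (g z)) = _ from funext fun z => h (g z),
    taylor_add (Finset.analyticAt_fun_sum _ fun i _ => hterm i) ((hg.fun_pow _).fun_mul hRg),
    taylor_sum _ hterm, taylor_mul (hg.fun_pow _) hRg, taylor_pow hg, map_add, map_sum,
    X_pow_dvd_iff.mp ((pow_dvd_pow_of_dvd hX (n + 1)).mul_right _) n n.lt_succ_self, add_zero]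
  refine Finset.sum_congr rfl fun k _ => ?_
  rw [taylor_const_mul _ (hg.fun_pow k), taylor_pow hg, coeff_C_mul]

theorem analyticAt_one_add_cpow (a : ℂ) : AnalyticAt ℂ (fun z : ℂ => (1 + z) ^ a) 0 :=
  Complex.one_add_cpow_hasFPowerSeriesAt_zero.analyticAt

theorem coeff_taylor_one_add_cpow (a : ℂ) (n : ℕ) :
    coeff n (taylor fun z : ℂ => (1 + z) ^ a) =
      fallingFactorial a n / (n.factorial : ℂ) := by
  rw [coeff_taylor_eq_of_hasFPowerSeriesAt (c := fun n => Ring.choose a n)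
    Complex.one_add_cpow_hasFPowerSeriesAt_zero, Ring.choose_eq_smul, fallingFactorial,
    smul_eq_mul, ← descPochhammer_map (algebraMap ℤ ℂ), Polynomial.eval_map,
    ← Polynomial.aeval_def, Polynomial.aeval_eq_smeval, div_eq_inv_mul]

theorem hasSum_taylor_of_differentiableOn {r : ℝ}
    (hf : DifferentiableOn ℂ f (Metric.ball 0 r)) {z : ℂ} (hz : ‖z‖ < r) :
    HasSum (fun n => coeff n (taylor f) * z ^ n) (f z) := by
  have := Complex.hasSum_taylorSeries_on_ball hf (z := z) (by simpa using hz)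
  refine (congrArg (HasSum · (f z)) (funext fun n => ?_)).mpr this
  rw [coeff_taylor, sub_zero, smul_eq_mul, smul_eq_mul]
  ring

end Taylor

/-! ### The branch `((1 + √(1 + v)) / 2)^{2x}` on the unit disc. -/

theorem cpow_half_sq (z : ℂ) : (z ^ (1 / 2 : ℂ)) ^ 2 = z := by
  rw [← Complex.cpow_nat_mul]
  norm_num

theorem cpow_third_cube (z : ℂ) : (z ^ (1 / 3 : ℂ)) ^ 3 = z := by
  rw [← Complex.cpow_nat_mul]
  norm_num

/-- The principal branch of `√(1 + v)`. -/
noncomputable def sqrtOneAdd (v : ℂ) : ℂ := (1 + v) ^ (1 / 2 : ℂ)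

/-- The deviation of `((1 + √(1 + v)) / 2)²` from `1`. -/
noncomputable def deviation (v : ℂ) : ℂ := v / 4 + (sqrtOneAdd v - 1) / 2

/-- The function `((1 + √(1 + v)) / 2)^{2x}`. -/
noncomputable def sqrtPower (x v : ℂ) : ℂ := (1 + deviation v) ^ x

theorem sqrtOneAdd_sq (v : ℂ) : sqrtOneAdd v ^ 2 = 1 + v :=
  cpow_half_sq (1 + v)

theorem one_add_deviation (v : ℂ) : 1 + deviation v = ((1 + sqrtOneAdd v) / 2) ^ 2 := by
  have := sqrtOneAdd_sq v
  rw [deviation]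
  linear_combination (-1 / 4) * this

/-- The principal root halves the argument, so it lies in the closed right half-plane. -/
theorem sqrtOneAdd_re_nonneg (v : ℂ) : 0 ≤ (sqrtOneAdd v).re := by
  by_cases h : 1 + v = 0
  · simp [sqrtOneAdd, h]
  · rw [sqrtOneAdd, Complex.cpow_def_of_ne_zero h, Complex.exp_re]
    refine mul_nonneg (Real.exp_pos _).le (Real.cos_nonneg_of_mem_Icc ?_)
    have him : (Complex.log (1 + v) * (1 / 2)).im = (1 + v).arg / 2 := by
      rw [show (1 / 2 : ℂ) = ((1 / 2 : ℝ) : ℂ) by norm_num, Complex.im_mul_ofReal, Complex.log_im]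
      ring
    rw [him]
    constructor <;> linarith [Complex.neg_pi_lt_arg (1 + v), Complex.arg_le_pi (1 + v)]

theorem one_add_sqrtOneAdd_ne_zero (v : ℂ) : 1 + sqrtOneAdd v ≠ 0 := by
  intro h
  have := congrArg Complex.re h
  simp only [Complex.add_re, Complex.one_re, Complex.zero_re] at this
  linarith [sqrtOneAdd_re_nonneg v]

theorem one_add_re_pos {v : ℂ} (hv : ‖v‖ < 1) : 0 < (1 + v).re := by
  have := (abs_le.mp (Complex.abs_re_le_norm v)).1
  simp only [Complex.add_re, Complex.one_re]
  linarith

theorem sqrtOneAdd_ne_zero {v : ℂ} (hv : ‖v‖ < 1) : sqrtOneAdd v ≠ 0 := by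
  intro h
  have h1 := sqrtOneAdd_sq v
  have h2 := one_add_re_pos hv
  rw [← h1, h] at h2
  simp at h2

/-- With `S = √(1 + v)`, `Re (1 + S)² = 1 + 2 Re S + Re (1 + v) > 0`. This makes the principal power
in `sqrtPower` holomorphic on the disc. -/
theorem one_add_deviation_mem_slitPlane {v : ℂ} (hv : ‖v‖ < 1) :
    1 + deviation v ∈ Complex.slitPlane := by
  refine Complex.mem_slitPlane_iff.mpr (Or.inl ?_)
  have h1 := one_add_re_pos hv
  have h2 := sqrtOneAdd_re_nonneg v
  rw [← sqrtOneAdd_sq v, sq, Complex.mul_re] at h1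
  rw [one_add_deviation, show ((1 + sqrtOneAdd v) / 2) ^ 2 =
    ((1 / 4 : ℝ) : ℂ) * ((1 + sqrtOneAdd v) * (1 + sqrtOneAdd v)) by push_cast; ring,
    Complex.re_ofReal_mul, Complex.mul_re]
  simp only [Complex.add_re, Complex.one_re, Complex.add_im, Complex.one_im]
  nlinarith

theorem sqrtOneAdd_zero : sqrtOneAdd 0 = 1 := by simp [sqrtOneAdd]

theorem deviation_zero : deviation 0 = 0 := by simp [deviation, sqrtOneAdd_zero]

theorem sqrtPower_zero (x : ℂ) : sqrtPower x 0 = 1 := by simp [sqrtPower, deviation_zero]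

theorem hasDerivAt_sqrtOneAdd {v : ℂ} (hv : ‖v‖ < 1) :
    HasDerivAt sqrtOneAdd (1 / (2 * sqrtOneAdd v)) v := by
  have hmem : 1 + v ∈ Complex.slitPlane := Complex.mem_slitPlane_iff.mpr (Or.inl (one_add_re_pos hv))
  have h := ((hasDerivAt_id v).const_add 1).cpow_const (c := 1 / 2) hmem
  have hS := sqrtOneAdd_ne_zero hv
  have hne : 1 + v ≠ 0 := Complex.slitPlane_ne_zero hmem
  refine h.congr_deriv ?_
  have hsq := sqrtOneAdd_sq v
  rw [id, Complex.cpow_sub _ _ hne, Complex.cpow_one, ← sqrtOneAdd, ← hsq]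
  field_simp

theorem hasDerivAt_sqrtPower (x : ℂ) {v : ℂ} (hv : ‖v‖ < 1) :
    HasDerivAt (sqrtPower x)
      (x * sqrtPower x v / (sqrtOneAdd v * (1 + sqrtOneAdd v))) v := by
  have hS := sqrtOneAdd_ne_zero hv
  have hS1 := one_add_sqrtOneAdd_ne_zero v
  have hmem := one_add_deviation_mem_slitPlane hv
  have hd : HasDerivAt (fun v => 1 + deviation v) (1 / 4 + 1 / (2 * sqrtOneAdd v) / 2) v :=
    (((hasDerivAt_id v).div_const 4).add
      (((hasDerivAt_sqrtOneAdd hv).sub_const 1).div_const 2)).const_add 1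
  refine (hd.cpow_const (c := x) hmem).congr_deriv ?_
  rw [Complex.cpow_sub _ _ (Complex.slitPlane_ne_zero hmem), Complex.cpow_one, ← sqrtPower,
    one_add_deviation]
  field_simp
  ring

theorem differentiableOn_sqrtOneAdd : DifferentiableOn ℂ sqrtOneAdd (Metric.ball 0 1) :=
  fun _ hv => (hasDerivAt_sqrtOneAdd (by simpa using hv)).differentiableAt.differentiableWithinAt

theorem differentiableOn_sqrtPower (x : ℂ) :
    DifferentiableOn ℂ (sqrtPower x) (Metric.ball 0 1) :=
  fun _ hv =>
    (hasDerivAt_sqrtPower x (by simpa using hv)).differentiableAt.differentiableWithinAt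

theorem analyticAt_sqrtOneAdd : AnalyticAt ℂ sqrtOneAdd 0 :=
  differentiableOn_sqrtOneAdd.analyticAt (Metric.ball_mem_nhds 0 one_pos)

theorem analyticAt_sqrtPower (x : ℂ) : AnalyticAt ℂ (sqrtPower x) 0 :=
  (differentiableOn_sqrtPower x).analyticAt (Metric.ball_mem_nhds 0 one_pos)

/-! ### The differential equation and the coefficient recursion. -/

section Series

open PowerSeries

theorem analyticAt_deviation : AnalyticAt ℂ deviation 0 :=
  (analyticAt_id.div_const (c := (4 : ℂ))).add ((analyticAt_sqrtOneAdd.sub analyticAt_const).div_const)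

theorem taylor_deviation :
    taylor deviation = C (1 / 4) * X + C (1 / 2) * (taylor sqrtOneAdd + C (-1)) := by
  have h1 : AnalyticAt ℂ (fun z : ℂ => z) 0 := analyticAt_id
  have h2 : AnalyticAt ℂ (fun z => sqrtOneAdd z + -1) 0 :=
    analyticAt_sqrtOneAdd.fun_add analyticAt_const
  rw [show deviation = fun z => (1 / 4) * z + (1 / 2) * (sqrtOneAdd z + -1) by
      ext z; rw [deviation]; ring,
    taylor_add (analyticAt_const.fun_mul h1) (analyticAt_const.fun_mul h2),
    taylor_const_mul _ h1, taylor_const_mul _ h2, taylor_id,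
    taylor_add analyticAt_sqrtOneAdd analyticAt_const, taylor_const]

theorem taylor_sqrtOneAdd_sq : taylor sqrtOneAdd ^ 2 = 1 + X := by
  have hid : AnalyticAt ℂ (fun z : ℂ => z) 0 := analyticAt_id
  rw [← taylor_pow analyticAt_sqrtOneAdd,
    show (fun z => sqrtOneAdd z ^ 2) = fun z => 1 + z from funext sqrtOneAdd_sq,
    taylor_add analyticAt_const hid, taylor_const, taylor_id, map_one]

theorem taylor_sqrtPower_ode (x : ℂ) :
    d⁄dX ℂ (taylor (sqrtPower x)) * (taylor sqrtOneAdd * (1 + taylor sqrtOneAdd)) =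
      C x * taylor (sqrtPower x) := by
  have h1 : AnalyticAt ℂ (fun z => 1 + sqrtOneAdd z) 0 :=
    analyticAt_const.fun_add analyticAt_sqrtOneAdd
  rw [← map_one C, ← taylor_const, ← taylor_add analyticAt_const analyticAt_sqrtOneAdd,
    ← taylor_mul analyticAt_sqrtOneAdd h1, ← taylor_deriv,
    ← taylor_mul (analyticAt_sqrtPower x).deriv (analyticAt_sqrtOneAdd.fun_mul h1),
    ← taylor_const_mul _ (analyticAt_sqrtPower x)]
  refine taylor_congr ?_
  filter_upwards [Metric.ball_mem_nhds (0 : ℂ) one_pos] with v hv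
  rw [mem_ball_zero_iff] at hv
  have := sqrtOneAdd_ne_zero hv
  have := one_add_sqrtOneAdd_ne_zero v
  rw [(hasDerivAt_sqrtPower x hv).deriv]
  field_simp

theorem two_mul_taylor_sqrtOneAdd_mul_derivative :
    2 * taylor sqrtOneAdd * d⁄dX ℂ (taylor sqrtOneAdd) = 1 := by
  have h := congrArg (d⁄dX ℂ) taylor_sqrtOneAdd_sq
  rw [derivative_pow, map_add, derivative_X, derivative_one] at h
  simpa using h

/-- Differentiating the first-order equation allows `√(1 + v)` to be eliminated; polynomial
coefficients remain, which is what a recursion needs. -/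
theorem taylor_sqrtPower_ode_second (x : ℂ) :
    4 * (X * (1 + X) * d⁄dX ℂ (d⁄dX ℂ (taylor (sqrtPower x))))
      + (2 * X + 4 * (1 - 2 * C x) * (1 + X)) * d⁄dX ℂ (taylor (sqrtPower x))
      - (1 - 2 * C x) * (2 * C x) * taylor (sqrtPower x) = 0 := by
  have h1 := taylor_sqrtPower_ode x
  have h2 := taylor_sqrtOneAdd_sq
  have h3 := two_mul_taylor_sqrtOneAdd_mul_derivative
  have h4 := congrArg (d⁄dX ℂ) h1
  simp only [Derivation.leibniz, map_add, derivative_one, derivative_C, smul_eq_mul] at h4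
  generalize taylor (sqrtPower x) = φ at *
  generalize taylor sqrtOneAdd = σ at *
  generalize d⁄dX ℂ (d⁄dX ℂ φ) = φ₂ at *
  generalize d⁄dX ℂ φ = φ₁ at *
  generalize d⁄dX ℂ σ = σ₁ at *
  generalize C x = ξ at *
  have hX : (X : PowerSeries ℂ) = σ ^ 2 - 1 := by rw [h2]; ring
  rw [hX]
  -- The multiplier turns the leading factor `σ (1 + σ)` into `4 σ² (σ² - 1) = 4 (1 + X) X`.
  linear_combination 4 * σ * (σ - 1) * h4 - 2 * (σ - 1) * (1 + 2 * σ) * φ₁ * h3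
    + 2 * (1 - 2 * ξ) * h1

theorem coeff_X_mul_derivative (φ : PowerSeries ℂ) (n : ℕ) :
    coeff n (X * d⁄dX ℂ φ) = n * coeff n φ := by
  cases n with
  | zero => simp
  | succ n => rw [coeff_succ_X_mul, coeff_derivative]; push_cast; ring

/-- The recursion for the Taylor coefficients of `((1 + √(1 + v)) / 2)^{2x}`. -/
theorem coeff_sqrtPower_succ (x : ℂ) (n : ℕ) :
    4 * ((n : ℂ) + 1) * (n + 1 - 2 * x) * coeff (n + 1) (taylor (sqrtPower x)) =
      -((2 * n - 2 * x) * (2 * n + 1 - 2 * x)) * coeff n (taylor (sqrtPower x)) := by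
  -- Rewritten with the Euler operator `X d/dX`, which multiplies the `n`-th coefficient by `n`.
  have h : C 4 * (X * d⁄dX ℂ (d⁄dX ℂ (taylor (sqrtPower x)))) +
      C 4 * (X * d⁄dX ℂ (X * d⁄dX ℂ (taylor (sqrtPower x))))
      + C (2 * (1 - 4 * x)) * (X * d⁄dX ℂ (taylor (sqrtPower x)))
      + C (4 * (1 - 2 * x)) * d⁄dX ℂ (taylor (sqrtPower x))
      - C ((1 - 2 * x) * (2 * x)) * taylor (sqrtPower x) = 0 := by
    rw [← taylor_sqrtPower_ode_second x]
    simp only [map_mul, map_sub, map_one, map_ofNat, Derivation.leibniz, derivative_X, smul_eq_mul]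
    ring
  have h := congrArg (coeff n) h
  simp only [map_add, map_sub, coeff_C_mul, map_zero, coeff_X_mul_derivative, coeff_derivative] at h
  linear_combination h

end Series

/-! ### Absolute summability of the coefficients and the triple sum. -/

section Coefficients

open PowerSeries

/-- The Taylor coefficients of `((1 + √(1 + v)) / 2)^{2x}`. -/
noncomputable def sqrtPowerCoeff (x : ℂ) (n : ℕ) : ℂ := coeff n (taylor (sqrtPower x))

theorem sqrtPowerCoeff_zero (x : ℂ) : sqrtPowerCoeff x 0 = 1 := by
  rw [sqrtPowerCoeff, coeff_zero_eq_constantCoeff_apply, constantCoeff_taylor, sqrtPower_zero]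

theorem hasSum_sqrtPowerCoeff (x : ℂ) {v : ℂ} (hv : ‖v‖ < 1) :
    HasSum (fun n => sqrtPowerCoeff x n * v ^ n) (sqrtPower x v) :=
  hasSum_taylor_of_differentiableOn (differentiableOn_sqrtPower x) hv

/-- By the recursion the difference on the right is `‖c_n‖ (2n + 2x - 4x²) / (4 (n + 1 - 2x))`. The
constant 12 is sharp at `n = 1`, `x = -1/3`. The right side telescopes, which gives summability. -/
theorem norm_sqrtPowerCoeff_le {x : ℝ} (hx : |x| ≤ 1 / 3) {n : ℕ} (hn : 1 ≤ n) :
    ‖sqrtPowerCoeff x n‖ ≤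
      12 * (n * ‖sqrtPowerCoeff x n‖ - (n + 1) * ‖sqrtPowerCoeff x (n + 1)‖) := by
  obtain ⟨hx1, hx2⟩ := abs_le.mp hx
  have hn' : (1 : ℝ) ≤ n := by exact_mod_cast hn
  have h : ((4 * ((n : ℝ) + 1) * (n + 1 - 2 * x) : ℝ) : ℂ) * sqrtPowerCoeff x (n + 1) =
      -((((2 * (n : ℝ) - 2 * x) * (2 * n + 1 - 2 * x) : ℝ) : ℂ) * sqrtPowerCoeff x n) := by
    have := coeff_sqrtPower_succ x n
    rw [← sqrtPowerCoeff, ← sqrtPowerCoeff] at this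
    push_cast
    rw [this, neg_mul]
  replace h := congrArg norm h
  rw [norm_neg, norm_mul, norm_mul,
    Complex.norm_of_nonneg (by apply mul_nonneg <;> linarith),
    Complex.norm_of_nonneg (by apply mul_nonneg <;> linarith)] at h
  have ha := norm_nonneg (sqrtPowerCoeff x n)
  generalize ‖sqrtPowerCoeff x n‖ = a at *
  generalize ‖sqrtPowerCoeff x (n + 1)‖ = b at *
  generalize (n : ℝ) = t at *
  have hD : 0 < 4 * (t + 1 - 2 * x) := by linarith
  refine le_of_mul_le_mul_left ?_ hD
  have key : 4 * (t + 1 - 2 * x) ≤ 12 * (2 * t + 2 * x - 4 * x ^ 2) := by nlinarith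
  nlinarith [mul_le_mul_of_nonneg_right key ha]

theorem summable_norm_sqrtPowerCoeff {x : ℝ} (hx : |x| ≤ 1 / 3) :
    Summable fun n => ‖sqrtPowerCoeff x n‖ := by
  rw [← summable_nat_add_iff 1]
  refine summable_of_sum_range_le (c := 12 * ‖sqrtPowerCoeff x 1‖) (fun _ => norm_nonneg _)
    fun N => ?_
  have : ∑ i ∈ Finset.range N, ‖sqrtPowerCoeff x (i + 1)‖ ≤
      12 * (‖sqrtPowerCoeff x 1‖ - (N + 1) * ‖sqrtPowerCoeff x (N + 1)‖) := by
    induction N with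
    | zero => simp
    | succ N ih =>
      rw [Finset.sum_range_succ]
      have := norm_sqrtPowerCoeff_le hx (Nat.succ_le_succ N.zero_le)
      push_cast at this ⊢
      linarith
  have h0 : 0 ≤ ((N : ℝ) + 1) * ‖sqrtPowerCoeff x (N + 1)‖ := by positivity
  linarith

theorem taylor_sqrtOneAdd_pow (l : ℕ) :
    taylor sqrtOneAdd ^ l = taylor fun v => (1 + v) ^ ((l : ℂ) / 2) := by
  rw [← taylor_pow analyticAt_sqrtOneAdd]
  congr 1
  ext v
  rw [sqrtOneAdd, ← Complex.cpow_nat_mul]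
  ring_nf

/-- The deviation is affine in `v` and `√(1 + v)`: two binomial expansions produce the indices `i`
and `l`, and `√(1 + v)^l` is again a binomial series. -/
theorem coeff_taylor_deviation_pow {k m : ℕ} (hkm : k ≤ m) :
    coeff m (taylor deviation ^ k) =
      ∑ i ∈ Finset.range (k + 1), ∑ l ∈ Finset.range (k - i + 1),
        (1 / 4) ^ i * (1 / 2) ^ (k - i) * (-1) ^ (k - i - l) * ((k - i).choose l : ℂ) *
          (k.choose i : ℂ) * (fallingFactorial ((l : ℂ) / 2) (m - i) / ((m - i).factorial : ℂ)) := by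
  rw [taylor_deviation, add_pow, map_sum]
  refine Finset.sum_congr rfl fun i hi => ?_
  rw [mul_pow, mul_pow, add_pow, Finset.mul_sum, Finset.mul_sum, Finset.sum_mul, map_sum]
  refine Finset.sum_congr rfl fun l _ => ?_
  have him : i ≤ m := (Nat.lt_succ_iff.mp (Finset.mem_range.mp hi)).trans hkm
  rw [taylor_sqrtOneAdd_pow, ← coeff_taylor_one_add_cpow]
  generalize taylor (fun v : ℂ => (1 + v) ^ ((l : ℂ) / 2)) = τ
  rw [show C (1 / 4 : ℂ) ^ i * X ^ i * (C (1 / 2 : ℂ) ^ (k - i) *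
      (τ * C (-1 : ℂ) ^ (k - i - l) * ((k - i).choose l : PowerSeries ℂ))) *
        (k.choose i : PowerSeries ℂ) =
      C ((1 / 4) ^ i * (1 / 2) ^ (k - i) * (-1) ^ (k - i - l) * ((k - i).choose l : ℂ) *
          (k.choose i : ℂ)) * (X ^ i * τ) by
      simp only [map_mul, map_pow, map_natCast]; ring,
    coeff_C_mul, coeff_X_pow_mul', if_pos him]

theorem tripleSum_eq (x : ℂ) {m : ℕ} (hm : 1 ≤ m) :
    tripleSum x m = ((3 * m).factorial : ℂ) * (4 / 3) ^ m * sqrtPowerCoeff x m := by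
  have hcomp : sqrtPowerCoeff x m = ∑ k ∈ Finset.range (m + 1),
      fallingFactorial x k / (k.factorial : ℂ) * coeff m (taylor deviation ^ k) := by
    simp_rw [← coeff_taylor_one_add_cpow]
    exact coeff_taylor_comp (analyticAt_one_add_cpow x) analyticAt_deviation deviation_zero m
  -- For `m ≥ 1` the index `k = 0` drops out, so the triple sum may start at `k = 1`.
  have h0 : coeff m (taylor deviation ^ 0) = 0 := by
    rw [pow_zero, coeff_one, if_neg (by omega)]
  have hIcc : sqrtPowerCoeff x m = ∑ k ∈ Finset.Icc 1 m,
      fallingFactorial x k / (k.factorial : ℂ) * coeff m (taylor deviation ^ k) := by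
    rw [hcomp]
    refine (Finset.sum_subset (fun k hk => ?_) fun k hk hk' => ?_).symm
    · rw [Finset.mem_Icc] at hk
      exact Finset.mem_range.mpr (by omega)
    · rw [Finset.mem_range] at hk
      rw [Finset.mem_Icc] at hk'
      rw [show k = 0 by omega, h0, mul_zero]
  rw [hIcc, tripleSum, Finset.mul_sum]
  refine Finset.sum_congr rfl fun k hk => ?_
  obtain ⟨-, hkm⟩ := Finset.mem_Icc.mp hk
  rw [coeff_taylor_deviation_pow hkm, Finset.mul_sum, Finset.mul_sum]
  refine Finset.sum_congr rfl fun i hi => ?_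
  rw [Finset.mul_sum, Finset.mul_sum]
  refine Finset.sum_congr rfl fun l hl => ?_
  rw [Finset.mem_range] at hi hl
  obtain ⟨j, rfl⟩ := Nat.exists_eq_add_of_le (Nat.lt_succ_iff.mp hi)
  rw [Nat.add_sub_cancel_left] at hl ⊢
  obtain ⟨q, rfl⟩ := Nat.exists_eq_add_of_le (Nat.lt_succ_iff.mp hl)
  obtain ⟨p, rfl⟩ := Nat.exists_eq_add_of_le ((Nat.le_add_right _ _).trans hkm)
  -- Splitting `(4/3)^m`, the part `(4/3)^i` meets `(1/4)^i` to give `3^{-i}`; the rest belongs to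
  -- `h`.
  rw [Nat.add_sub_cancel_left, Nat.add_sub_cancel_left, h,
    show (i : ℤ) - ((i + (l + q) : ℕ) : ℤ) = -((l + q : ℕ) : ℤ) by push_cast; ring, zpow_neg,
    zpow_natCast, Nat.cast_choose ℂ (Nat.le_add_right l q),
    Nat.cast_choose ℂ (Nat.le_add_right i (l + q)), Nat.add_sub_cancel_left,
    Nat.add_sub_cancel_left, pow_add (4 / 3 : ℂ) i p, div_pow, div_pow, div_pow, div_pow, one_pow,
    one_pow]
  have hfac : ∀ n : ℕ, (n.factorial : ℂ) ≠ 0 := fun n =>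
    Nat.cast_ne_zero.mpr n.factorial_ne_zero
  have h1 := hfac i
  have h2 := hfac l
  have h3 := hfac q
  have h4 := hfac p
  have h5 := hfac (l + q)
  have h6 := hfac (i + (l + q))
  field_simp

end Coefficients

/-! ### Reduction of `χ` and its coefficients to `sqrtPower`. -/

theorem ofReal_mul_cpow {r : ℝ} (hr : 0 < r) {z : ℂ} (hz : z ≠ 0) (a : ℂ) :
    ((r : ℂ) * z) ^ a = (r : ℂ) ^ a * z ^ a := by
  have hr' : (r : ℂ) ≠ 0 := Complex.ofReal_ne_zero.mpr hr.ne'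
  rw [Complex.cpow_def_of_ne_zero (mul_ne_zero hr' hz), Complex.cpow_def_of_ne_zero hr',
    Complex.cpow_def_of_ne_zero hz, Complex.log_ofReal_mul hr hz, Complex.ofReal_log hr.le,
    ← Complex.exp_add, add_mul]

theorem sqrt_three_sq : (Real.sqrt 3 : ℂ) ^ 2 = 3 := by
  rw [← Complex.ofReal_pow, Real.sq_sqrt (by norm_num)]
  norm_num

theorem eta_sq (t : ℂ) : eta t ^ 2 = 3 + 4 * t ^ 3 :=
  cpow_half_sq _

theorem chi_cube (t : ℂ) : chi t ^ 3 = 3 + 2 * t ^ 3 + (Real.sqrt 3 : ℂ) * eta t :=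
  cpow_third_cube _

theorem eta_eq {t : ℂ} (ht : ‖4 / 3 * t ^ 3‖ < 1) :
    eta t = (Real.sqrt 3 : ℂ) * sqrtOneAdd (4 / 3 * t ^ 3) := by
  have h0 : 1 + 4 / 3 * t ^ 3 ≠ 0 := fun h => by
    simpa [h] using one_add_re_pos ht
  have h3 : ((3 : ℝ) : ℂ) ^ (1 / 2 : ℂ) = (Real.sqrt 3 : ℂ) := by
    rw [Real.sqrt_eq_rpow, Complex.ofReal_cpow (by norm_num)]
    norm_num
  rw [eta, show 3 + 4 * t ^ 3 = ((3 : ℝ) : ℂ) * (1 + 4 / 3 * t ^ 3) by push_cast; ring,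
    ofReal_mul_cpow (by norm_num) h0, h3, sqrtOneAdd]

theorem chi_eq {t : ℂ} (ht : ‖4 / 3 * t ^ 3‖ < 1) :
    chi t = (6 : ℂ) ^ (1 / 3 : ℂ) * sqrtPower (1 / 3) (4 / 3 * t ^ 3) := by
  have h0 := Complex.slitPlane_ne_zero (one_add_deviation_mem_slitPlane ht)
  rw [chi, eta_eq ht, sqrtPower, show (6 : ℂ) = ((6 : ℝ) : ℂ) by norm_num,
    ← ofReal_mul_cpow (by norm_num) h0, deviation]
  congr 1
  push_cast
  linear_combination sqrtOneAdd (4 / 3 * t ^ 3) * sqrt_three_sq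

theorem chi_ne_zero {t : ℂ} (ht : ‖4 / 3 * t ^ 3‖ < 1) : chi t ≠ 0 := by
  rw [chi_eq ht]
  refine mul_ne_zero (by simp [Complex.cpow_eq_zero_iff]) ?_
  have h0 := Complex.slitPlane_ne_zero (one_add_deviation_mem_slitPlane ht)
  rw [sqrtPower]
  simp [Complex.cpow_eq_zero_iff, h0]

theorem inv_chi_eq {t : ℂ} (ht : ‖4 / 3 * t ^ 3‖ < 1) :
    (chi t)⁻¹ = (6 : ℂ) ^ (-(1 / 3) : ℂ) * sqrtPower (-(1 / 3)) (4 / 3 * t ^ 3) := by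
  rw [chi_eq ht, mul_inv, Complex.cpow_neg, sqrtPower, sqrtPower, Complex.cpow_neg]

open PowerSeries in
theorem coeffA_eq (m : ℕ) :
    coeffA m = (6 : ℂ) ^ (1 / 3 : ℂ) *
      (((3 * m).factorial : ℂ) * (4 / 3) ^ m * sqrtPowerCoeff (1 / 3) m) := by
  have hid : AnalyticAt ℂ (fun z : ℂ => z) 0 := analyticAt_id
  have hg : AnalyticAt ℂ (fun t : ℂ => 4 / 3 * t ^ 3) 0 := analyticAt_const.fun_mul (hid.fun_pow 3)
  have hgt : taylor (fun t : ℂ => 4 / 3 * t ^ 3) = C (4 / 3) * X ^ 3 := by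
    rw [taylor_const_mul _ (hid.fun_pow 3), taylor_pow hid, taylor_id]
  have hg0 : (4 / 3 : ℂ) * 0 ^ 3 = 0 := by norm_num
  have hcomp := coeff_taylor_comp (analyticAt_sqrtPower (1 / 3)) hg hg0 (3 * m)
  have hcongr : chi =ᶠ[𝓝 0] fun t =>
      (6 : ℂ) ^ (1 / 3 : ℂ) * sqrtPower (1 / 3) (4 / 3 * t ^ 3) := by
    have hev : ∀ᶠ t : ℂ in 𝓝 0, ‖4 / 3 * t ^ 3‖ < 1 := by
      have hc : ContinuousAt (fun t : ℂ => ‖4 / 3 * t ^ 3‖) 0 := by fun_prop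
      exact hc.eventually_lt_const (by norm_num)
    filter_upwards [hev] with t ht using chi_eq ht
  have hfac := Nat.cast_ne_zero (R := ℂ).mpr (3 * m).factorial_ne_zero
  have hA : coeffA m = ((3 * m).factorial : ℂ) * coeff (3 * m) (taylor chi) := by
    rw [coeff_taylor, coeffA]
    field_simp
  have hcompA : AnalyticAt ℂ (fun t => sqrtPower (1 / 3) (4 / 3 * t ^ 3)) 0 :=
    AnalyticAt.fun_comp (by rw [hg0]; exact analyticAt_sqrtPower _) hg
  -- The inner function is a monomial, so only `k = m` survives in the composition formula.
  have hterm : ∀ k, coeff (3 * m) ((C (4 / 3 : ℂ) * X ^ 3) ^ k) =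
      if k = m then (4 / 3 : ℂ) ^ m else 0 := fun k => by
    rw [mul_pow, ← pow_mul, ← map_pow, coeff_C_mul, coeff_X_pow]
    by_cases hk : k = m
    · simp [hk]
    · rw [if_neg hk, if_neg (by omega), mul_zero]
  rw [hA, taylor_congr hcongr, taylor_const_mul _ hcompA, coeff_C_mul, hcomp, hgt]
  simp_rw [hterm]
  simp only [mul_ite, mul_zero, Finset.sum_ite_eq', Finset.mem_range]
  rw [if_pos (by omega), sqrtPowerCoeff]
  ring

theorem coeffB_eq (m : ℕ) :
    coeffB m = (6 : ℂ) ^ (-(1 / 3) : ℂ) *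
      (((3 * m).factorial : ℂ) * (4 / 3) ^ m * sqrtPowerCoeff (-(1 / 3)) m) := by
  rw [coeffB]
  rcases Nat.eq_zero_or_pos m with rfl | hm
  · simp [tripleSum, sqrtPowerCoeff_zero]
  · rw [tripleSum_eq _ hm, if_neg hm.ne', zero_add]

/-! ### Sums and bounds for the two series. -/

theorem sqrtW_sq (w : ℂ) : sqrtW w ^ 2 = w :=
  cpow_half_sq w

theorem sqrtW_cube (w : ℂ) : w ^ (3 / 2 : ℂ) = sqrtW w ^ 3 := by
  rw [sqrtW, ← Complex.cpow_nat_mul]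
  norm_num

theorem cpow_three_mul_div_two (w : ℂ) (m : ℕ) :
    w ^ (3 * (m : ℂ) / 2) = (sqrtW w ^ 3) ^ m := by
  rw [← pow_mul, sqrtW, ← Complex.cpow_nat_mul]
  push_cast
  ring_nf

theorem norm_sqrtW {w : ℂ} (hw : ‖w‖ = 1) : ‖sqrtW w‖ = 1 := by
  have := congrArg norm (sqrtW_sq w)
  rw [norm_pow, hw] at this
  exact (pow_eq_one_iff_of_nonneg (norm_nonneg _) two_ne_zero).mp this

theorem norm_cube_lt {s : ℂ} (hs : s ∈ puncturedDisc) : ‖s‖ ^ 3 < 3 / 4 := by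
  have h := pow_lt_pow_left₀ hs.2 (norm_nonneg s) three_ne_zero
  rwa [← Real.rpow_natCast ((3 / 4 : ℝ) ^ (1 / 3 : ℝ)), ← Real.rpow_mul (by norm_num),
    Nat.cast_ofNat, one_div_mul_cancel three_ne_zero, Real.rpow_one] at h

theorem norm_arg_lt_one {w s : ℂ} (hw : ‖w‖ = 1) (hs : s ∈ puncturedDisc) :
    ‖4 / 3 * (s * sqrtW w) ^ 3‖ < 1 := by
  have := norm_cube_lt hs
  rw [norm_mul, norm_pow, norm_mul, norm_sqrtW hw, mul_one]
  norm_num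
  linarith

theorem termA_eq (w : ℂ) (m : ℕ) {s : ℂ} (hs : s ≠ 0) :
    termA w m s = (6 : ℂ) ^ (1 / 3 : ℂ) / s *
      (sqrtPowerCoeff (1 / 3) m * (4 / 3 * (s * sqrtW w) ^ 3) ^ m) := by
  have hfac := Nat.cast_ne_zero (R := ℂ).mpr (3 * m).factorial_ne_zero
  rw [termA, coeffA_eq, cpow_three_mul_div_two, zpow_sub_one₀ hs,
    show (3 * (m : ℤ)) = ((3 * m : ℕ) : ℤ) by push_cast; ring, zpow_natCast, pow_mul s 3 m,
    mul_pow s, mul_pow (4 / 3 : ℂ), mul_pow (s ^ 3)]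
  generalize (6 : ℂ) ^ (1 / 3 : ℂ) = c
  field_simp

theorem termB_eq (w : ℂ) (m : ℕ) (s : ℂ) :
    termB w m s = (6 : ℂ) ^ (-(1 / 3) : ℂ) * s *
      (sqrtPowerCoeff (-(1 / 3)) m * (4 / 3 * (s * sqrtW w) ^ 3) ^ m) := by
  have hfac := Nat.cast_ne_zero (R := ℂ).mpr (3 * m).factorial_ne_zero
  rw [termB, coeffB_eq, cpow_three_mul_div_two, pow_succ s, pow_mul s 3 m,
    mul_pow s, mul_pow (4 / 3 : ℂ), mul_pow (s ^ 3)]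
  generalize (6 : ℂ) ^ (-(1 / 3) : ℂ) = c
  field_simp

theorem hasSum_termA {w s : ℂ} (hw : ‖w‖ = 1) (hs : s ∈ puncturedDisc) :
    HasSum (fun m => termA w m s) (chi (s * sqrtW w) / s) := by
  have ht := norm_arg_lt_one hw hs
  simp_rw [termA_eq w _ hs.1]
  rw [chi_eq ht, mul_div_right_comm]
  exact (hasSum_sqrtPowerCoeff _ ht).mul_left _

theorem hasSum_termB {w s : ℂ} (hw : ‖w‖ = 1) (hs : s ∈ puncturedDisc) :
    HasSum (fun m => termB w m s) (s / chi (s * sqrtW w)) := by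
  have ht := norm_arg_lt_one hw hs
  have hval : s / chi (s * sqrtW w) = (6 : ℂ) ^ (-(1 / 3) : ℂ) * s *
      sqrtPower (-(1 / 3)) (4 / 3 * (s * sqrtW w) ^ 3) := by
    rw [div_eq_mul_inv s, inv_chi_eq ht]
    ring
  simp_rw [termB_eq w]
  rw [hval]
  exact (hasSum_sqrtPowerCoeff _ ht).mul_left _

theorem norm_lt_one {s : ℂ} (hs : s ∈ puncturedDisc) : ‖s‖ < 1 := by
  have h := norm_cube_lt hs
  by_contra! h1
  linarith [one_le_pow₀ h1 (n := 3)]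

/-- The term `m = 0` is `6^{1/3} / s`, unbounded near `0`. For `m ≥ 1` one factor `v` absorbs the `1
/ s`. -/
theorem norm_termA_le {w s : ℂ} (hw : ‖w‖ = 1) (hs : s ∈ puncturedDisc) {m : ℕ} (hm : 1 ≤ m) :
    ‖termA w m s‖ ≤ ‖(6 : ℂ) ^ (1 / 3 : ℂ)‖ * (4 / 3) * ‖sqrtPowerCoeff (1 / 3) m‖ := by
  have ht := (norm_arg_lt_one hw hs).le
  obtain ⟨n, rfl⟩ := Nat.exists_eq_add_of_le' hm
  have hs0 := hs.1
  have key : termA w (n + 1) s = (6 : ℂ) ^ (1 / 3 : ℂ) * (4 / 3) * sqrtPowerCoeff (1 / 3) (n + 1) *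
      ((4 / 3 * (s * sqrtW w) ^ 3) ^ n * (s ^ 2 * sqrtW w ^ 3)) := by
    rw [termA_eq w _ hs0, pow_succ]
    generalize (6 : ℂ) ^ (1 / 3 : ℂ) = c
    field_simp
  rw [key, norm_mul, norm_mul, norm_mul, norm_mul (_ ^ n), norm_mul (s ^ 2), norm_pow, norm_pow,
    norm_pow, norm_sqrtW hw, one_pow, mul_one, show ‖(4 / 3 : ℂ)‖ = 4 / 3 by norm_num]
  refine mul_le_of_le_one_right (by positivity) (mul_le_one₀ (pow_le_one₀ (norm_nonneg _) ht)
    (by positivity) (pow_le_one₀ (norm_nonneg _) (norm_lt_one hs).le))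

theorem norm_termB_le {w s : ℂ} (hw : ‖w‖ = 1) (hs : s ∈ puncturedDisc) (m : ℕ) :
    ‖termB w m s‖ ≤ ‖(6 : ℂ) ^ (-(1 / 3) : ℂ)‖ * ‖sqrtPowerCoeff (-(1 / 3)) m‖ := by
  have ht := (norm_arg_lt_one hw hs).le
  rw [termB_eq, norm_mul, norm_mul, norm_mul, norm_pow, mul_assoc]
  refine mul_le_mul_of_nonneg_left ?_ (norm_nonneg _)
  refine (mul_le_of_le_one_left (by positivity) (norm_lt_one hs).le).trans ?_
  exact mul_le_of_le_one_right (norm_nonneg _) (pow_le_one₀ (norm_nonneg _) ht)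

theorem summable_norm_sqrtPowerCoeff_third : Summable fun n => ‖sqrtPowerCoeff (1 / 3) n‖ := by
  simpa using summable_norm_sqrtPowerCoeff (x := 1 / 3) (by norm_num [abs_of_pos])

theorem summable_norm_sqrtPowerCoeff_neg_third :
    Summable fun n => ‖sqrtPowerCoeff (-(1 / 3)) n‖ := by
  simpa using summable_norm_sqrtPowerCoeff (x := -(1 / 3))
    (by norm_num [abs_of_pos])

/-! ### Cardano's formula and the three roots. -/

theorem two_cpow_third_cube : ((2 : ℂ) ^ (1 / 3 : ℂ)) ^ 3 = 2 :=
  cpow_third_cube 2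

theorem two_cpow_two_thirds : (2 : ℂ) ^ (2 / 3 : ℂ) = ((2 : ℂ) ^ (1 / 3 : ℂ)) ^ 2 := by
  rw [← Complex.cpow_nat_mul]
  norm_num

theorem two_cpow_four_thirds : (2 : ℂ) ^ (4 / 3 : ℂ) = 2 * (2 : ℂ) ^ (1 / 3 : ℂ) := by
  rw [show (4 / 3 : ℂ) = 1 + 1 / 3 by norm_num, Complex.cpow_add _ _ two_ne_zero, Complex.cpow_one]

/-- Cardano's formula: the solutions of the depressed cubic `a³ = 3pq a + p³ + q³`. -/
theorem cardano (p q a : ℂ) :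
    a ^ 3 - 3 * (p * q) * a - (p ^ 3 + q ^ 3) = 0 ↔
      a = p + q ∨
      a = -((1 - Complex.I * (Real.sqrt 3 : ℂ)) / 2 * p)
        - (1 + Complex.I * (Real.sqrt 3 : ℂ)) / 2 * q ∨
      a = -((1 + Complex.I * (Real.sqrt 3 : ℂ)) / 2 * p)
        - (1 - Complex.I * (Real.sqrt 3 : ℂ)) / 2 * q := by
  have hI : (Complex.I * (Real.sqrt 3 : ℂ)) ^ 2 = -3 := by
    rw [mul_pow, sqrt_three_sq, Complex.I_sq]; ring
  generalize Complex.I * (Real.sqrt 3 : ℂ) = r at *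
  have hfac : a ^ 3 - 3 * (p * q) * a - (p ^ 3 + q ^ 3) =
      (a - (p + q)) * ((a - (-((1 - r) / 2 * p) - (1 + r) / 2 * q)) *
        (a - (-((1 + r) / 2 * p) - (1 - r) / 2 * q))) := by
    linear_combination (a - (p + q)) * (p - q) ^ 2 / 4 * hI
  rw [hfac, mul_eq_zero, mul_eq_zero, sub_eq_zero, sub_eq_zero, sub_eq_zero]

/-- In Cardano's notation `p` and `q` are the two summands of `alpha1`; they satisfy `p q = w` and
`p³ + q³ = 2 w^{3/2} + 3 / s³`. -/
theorem isCubicRoot_iff {w s : ℂ} (hw : ‖w‖ = 1) (hs : s ∈ puncturedDisc) (a : ℂ) :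
    IsCubicRoot w s a ↔ a = alpha1 w s ∨ a = alpha2 w s ∨ a = alpha3 w s := by
  have ht := norm_arg_lt_one hw hs
  have hs0 := hs.1
  have hχ := chi_ne_zero ht
  have hχ3 := chi_cube (s * sqrtW w)
  have hη := eta_sq (s * sqrtW w)
  have hc := two_cpow_third_cube
  have hc0 : (2 : ℂ) ^ (1 / 3 : ℂ) ≠ 0 := fun h => by rw [h] at hc; norm_num at hc
  have h3 := sqrt_three_sq
  have hw2 := sqrtW_sq w
  rw [IsCubicRoot, alpha1, alpha2, alpha3, two_cpow_two_thirds, two_cpow_four_thirds, sqrtW_cube]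
  have hcardano := cardano (chi (s * sqrtW w) / ((2 : ℂ) ^ (1 / 3 : ℂ) * s))
    ((2 : ℂ) ^ (1 / 3 : ℂ) * s * w / chi (s * sqrtW w)) a
  generalize chi (s * sqrtW w) = χ at *
  generalize eta (s * sqrtW w) = η at *
  generalize (2 : ℂ) ^ (1 / 3 : ℂ) = c at *
  generalize sqrtW w = q at *
  generalize (Real.sqrt 3 : ℂ) = r at *
  subst hw2
  have hpq : χ / (c * s) * (c * s * q ^ 2 / χ) = q ^ 2 := by field_simp
  -- Conjugate radicands: with `T = (s q)³`, `(3 + 2T)² - 3 (3 + 4T) = 4T²`.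
  have hconj : χ ^ 3 * (3 + 2 * (s * q) ^ 3 - r * η) = 4 * (s * q) ^ 6 := by
    rw [hχ3]
    linear_combination -r ^ 2 * hη - (3 + 4 * (s * q) ^ 3) * h3
  have hcube : (χ / (c * s)) ^ 3 + (c * s * q ^ 2 / χ) ^ 3 = 2 * q ^ 3 + 3 / s ^ 3 := by
    have e1 : (χ / (c * s)) ^ 3 = χ ^ 3 / (2 * s ^ 3) := by rw [div_pow, mul_pow, hc]
    have e2 : (c * s * q ^ 2 / χ) ^ 3 = (3 + 2 * (s * q) ^ 3 - r * η) / (2 * s ^ 3) := by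
      rw [div_pow, mul_pow, mul_pow, hc, div_eq_div_iff (pow_ne_zero 3 hχ) (by simp [hs0])]
      linear_combination -hconj
    rw [e1, e2, hχ3]
    field_simp
    ring
  rw [hpq, hcube] at hcardano
  have e1 : ∀ e : ℂ, e * χ / (2 * c * s) = e / 2 * (χ / (c * s)) := fun e => by field_simp
  have e2 : ∀ e : ℂ, e * s * q ^ 2 / (c ^ 2 * χ) = e / 2 * (c * s * q ^ 2 / χ) := fun e => by
    rw [← mul_div_assoc, div_eq_div_iff (mul_ne_zero (pow_ne_zero 2 hc0) hχ) hχ]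
    linear_combination -(e * s * q ^ 2 * χ / 2) * hc
  rw [e1, e1, e2, e2, ← hcardano]
  constructor
  · intro h
    linear_combination (-3) * h
  · intro h
    linear_combination (-1 / 3) * h

end AiryCubic

theorem corollary1 (w : ℂ) (hw : ‖w‖ = 1) :
    -- `α₁, α₂, α₃` are the solutions of the cubic equation
    (∀ s ∈ AiryCubic.puncturedDisc, ∀ a : ℂ,
      AiryCubic.IsCubicRoot w s a ↔
        a = AiryCubic.alpha1 w s ∨ a = AiryCubic.alpha2 w s ∨ a = AiryCubic.alpha3 w s) ∧
    -- both series converge, and give `α₂` and `α₃`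
    (∀ s ∈ AiryCubic.puncturedDisc,
      Summable (fun m : ℕ => AiryCubic.termA w m s) ∧
      Summable (fun m : ℕ => AiryCubic.termB w m s) ∧
      AiryCubic.alpha2 w s =
        -((1 - Complex.I * (Real.sqrt 3 : ℂ)) / (2 : ℂ) ^ (4 / 3 : ℂ))
            * ∑' m : ℕ, AiryCubic.termA w m s
          - (1 + Complex.I * (Real.sqrt 3 : ℂ)) / (2 : ℂ) ^ (2 / 3 : ℂ) * w
            * ∑' m : ℕ, AiryCubic.termB w m s ∧
      AiryCubic.alpha3 w s =
        -((1 + Complex.I * (Real.sqrt 3 : ℂ)) / (2 : ℂ) ^ (4 / 3 : ℂ))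
            * ∑' m : ℕ, AiryCubic.termA w m s
          - (1 - Complex.I * (Real.sqrt 3 : ℂ)) / (2 : ℂ) ^ (2 / 3 : ℂ) * w
            * ∑' m : ℕ, AiryCubic.termB w m s) ∧
    -- the convergence of both series is uniform on the whole punctured disc
    TendstoUniformlyOn (fun (N : ℕ) (s : ℂ) => ∑ m ∈ Finset.range N, AiryCubic.termA w m s)
      (fun s : ℂ => ∑' m : ℕ, AiryCubic.termA w m s) atTop AiryCubic.puncturedDisc ∧
    TendstoUniformlyOn (fun (N : ℕ) (s : ℂ) => ∑ m ∈ Finset.range N, AiryCubic.termB w m s)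
      (fun s : ℂ => ∑' m : ℕ, AiryCubic.termB w m s) atTop AiryCubic.puncturedDisc ∧
    -- the explicit values of the coefficients `a_{3m} = χ^{(3m)}(0)`
    AiryCubic.coeffA 0 = (6 : ℂ) ^ (1 / 3 : ℂ) ∧
    (∀ m : ℕ, 1 ≤ m →
      AiryCubic.coeffA m = (6 : ℂ) ^ (1 / 3 : ℂ) * AiryCubic.tripleSum (1 / 3) m) := by
  refine ⟨fun s hs a => AiryCubic.isCubicRoot_iff hw hs a, fun s hs => ?_, ?_, ?_, ?_, ?_⟩
  · have hA := AiryCubic.hasSum_termA hw hs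
    have hB := AiryCubic.hasSum_termB hw hs
    refine ⟨hA.summable, hB.summable, ?_, ?_⟩
    · rw [hA.tsum_eq, hB.tsum_eq, AiryCubic.alpha2]
      ring
    · rw [hA.tsum_eq, hB.tsum_eq, AiryCubic.alpha3]
      ring
  -- The eventual form of the Weierstrass test is needed because the term `m = 0` has no uniform
  -- bound.
  · refine tendstoUniformlyOn_tsum_nat_eventually
      (AiryCubic.summable_norm_sqrtPowerCoeff_third.mul_left (‖(6 : ℂ) ^ (1 / 3 : ℂ)‖ * (4 / 3))) ?_
    filter_upwards [eventually_ge_atTop 1] with m hm s hs using AiryCubic.norm_termA_le hw hs hm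
  · exact tendstoUniformlyOn_tsum_nat
      (AiryCubic.summable_norm_sqrtPowerCoeff_neg_third.mul_left ‖(6 : ℂ) ^ (-(1 / 3) : ℂ)‖)
      fun m s hs => AiryCubic.norm_termB_le hw hs m
  · rw [AiryCubic.coeffA_eq, AiryCubic.sqrtPowerCoeff_zero]
    simp
  · intro m hm
    rw [AiryCubic.coeffA_eq, AiryCubic.tripleSum_eq _ hm]
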